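/- All Hilbert spaces are complex and all subspaces closed. A subspace $V$ of a Hilbert space $H$ is called $A$-hyperinvariant, for $A\in B(H)$, if $S(V)\subseteq V$ for every $S\in B(H)$ that commutes with $A$. A $*$-representation $\pi:M\to B(H_\pi)$ of a von Neumann algebra $M$ is understood to be unital; it is faithful if it is injective, and normal if it is continuous for the ultraweak ($\sigma$-weak) topologies of $M$ and $B(H_\pi)$. Let $H$ be a Hilbert space, let $M\subseteq B(H)$ be a von Neumann algebra, let $A\in M$, and let $p\in M$ be a projection, i.e. a self-adjoint idempotent. (1) If $pH$ is $A$-hyperinvariant, then for every normal, faithful $*$-representation $\pi:M\to B(H_\pi)$ of $M$ the subspace $\pi(p)H_\pi$ is $\pi(A)$-hyperinvariant. (2) Consequently, being a hyperinvariant projection of $A$ does not depend on the representation: for any two normal, faithful $*$-representations $\pi_1:M\to B(H_1)$ and $\pi_2:M\to B(H_2)$ of $M$, the subspace $\pi_1(p)H_1$ is $\pi_1(A)$-hyperinvariant if and only if $\pi_2(p)H_2$ is $\pi_2(A)$-hyperinvariant. -/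

import Mathlib

/-- A subspace `V` of a Hilbert space is `A`-hyperinvariant if it is closed and is mapped into
itself by every bounded operator that commutes with `A`. -/
def IsHyperinvariant {H : Type*} [NormedAddCommGroup H] [InnerProductSpace ℂ H]
    (A : H →L[ℂ] H) (V : Submodule ℂ H) : Prop :=
  IsClosed (V : Set H) ∧ ∀ S : H →L[ℂ] H, S * A = A * S → ∀ x ∈ V, S x ∈ V

/-- The ultraweak (σ-weak) topology on the bounded operators on `H`: the coarsest topology for
which all the functionals `T ↦ ∑ₙ ⟪ξₙ, T ηₙ⟫`, with `ξ` and `η` square-summable sequences of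
vectors, are continuous. -/
noncomputable abbrev ultraweakTopology (H : Type*) [NormedAddCommGroup H] [InnerProductSpace ℂ H] :
    TopologicalSpace (H →L[ℂ] H) :=
  ⨅ (ξ : lp (fun _ : ℕ => H) 2) (η : lp (fun _ : ℕ => H) 2),
    TopologicalSpace.induced (fun T : H →L[ℂ] H => ∑' n, inner ℂ (ξ n) (T (η n)))
      (inferInstance : TopologicalSpace ℂ)

/-- A (unital) `*`-representation of a von Neumann algebra on a Hilbert space is normal if it is
ultraweakly continuous. -/
def IsNormalRep {H K : Type*}
    [NormedAddCommGroup H] [InnerProductSpace ℂ H] [CompleteSpace H]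
    [NormedAddCommGroup K] [InnerProductSpace ℂ K] [CompleteSpace K]
    {M : VonNeumannAlgebra H} (π : M.toStarSubalgebra →⋆ₐ[ℂ] (K →L[ℂ] K)) : Prop :=
  @Continuous M.toStarSubalgebra (K →L[ℂ] K)
    ((ultraweakTopology H).induced Subtype.val) (ultraweakTopology K) π

/-! If `S` commutes with `σ A` and `Y`, `X` intertwine `ρ` with `σ` and back, then `X S Y` commutes
with `ρ A`, so it preserves the range of `ρ p`. Hence `X (1 - σ p) S (σ p) Y = 0`. When the ranges
of the `Y` are total, `X` and `Y` cancel, since every `Y⋆` is an admissible `X`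
(`IntertwinersTotal.isHyperinvariant`). It remains to find enough intertwiners. Normality gives
totality from the identity representation to `π`; faithfulness gives it in the other direction. Part
(2) composes the two through `H`. -/

open scoped InnerProductSpace

/-! ### Amplifications to `ℓ²(I, H)` -/

section Amplification

variable {H : Type*} [NormedAddCommGroup H] [InnerProductSpace ℂ H] {I : Type*}

theorem memℓp_two_comp (T : H →L[ℂ] H) (f : lp (fun _ : I => H) 2) :
    Memℓp (fun i => T (f i)) 2 := by
  refine memℓp_gen ?_
  have hf := ((lp.memℓp f).summable (by norm_num)).mul_left (‖T‖ ^ (2 : ℝ))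
  simp only [ENNReal.toReal_ofNat, Real.rpow_ofNat] at hf ⊢
  refine hf.of_nonneg_of_le (fun i => by positivity) fun i => ?_
  rw [← mul_pow]
  gcongr
  exact T.le_opNorm _

/-- The diagonal operator on `ℓ²(I, H)` with all entries equal to `T`. -/
noncomputable def diagonalOperator (T : H →L[ℂ] H) :
    lp (fun _ : I => H) 2 →L[ℂ] lp (fun _ : I => H) 2 :=
  LinearMap.mkContinuous
    { toFun := fun f => ⟨fun i => T (f i), memℓp_two_comp T f⟩
      map_add' := fun f g => by ext i; exact map_add T (f i) (g i)
      map_smul' := fun c f => by ext i; exact map_smul T c (f i) } ‖T‖ fun f => by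
    refine lp.norm_le_of_forall_sum_le (by norm_num) (by positivity) fun s => ?_
    have hf := lp.sum_rpow_le_norm_rpow (p := 2) (by norm_num) f s
    simp only [ENNReal.toReal_ofNat, Real.rpow_ofNat, mul_pow] at hf ⊢
    calc ∑ i ∈ s, ‖T (f i)‖ ^ 2 ≤ ∑ i ∈ s, ‖T‖ ^ 2 * ‖f i‖ ^ 2 := by
          gcongr with i
          rw [← mul_pow]
          gcongr
          exact T.le_opNorm _
      _ ≤ ‖T‖ ^ 2 * ‖f‖ ^ 2 := by
          rw [← Finset.mul_sum]
          gcongr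

@[simp]
theorem diagonalOperator_apply (T : H →L[ℂ] H) (f : lp (fun _ : I => H) 2) (i : I) :
    diagonalOperator T f i = T (f i) := rfl

theorem diagonalOperator_single [DecidableEq I] (T : H →L[ℂ] H) (i : I) (x : H) :
    diagonalOperator T (lp.single 2 i x) = lp.single (E := fun _ : I => H) 2 i (T x) := by
  ext j
  by_cases h : j = i
  · subst h; simp
  · simp [h]

/-- The amplification of the identity representation to `ℓ²(I, H)`. -/
noncomputable def amplification (H : Type*) [NormedAddCommGroup H] [InnerProductSpace ℂ H]
    [CompleteSpace H] (I : Type*) :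
    (H →L[ℂ] H) →⋆ₐ[ℂ] (lp (fun _ : I => H) 2 →L[ℂ] lp (fun _ : I => H) 2) where
  toFun := diagonalOperator
  map_one' := by ext; simp
  map_mul' S T := by ext; simp
  map_zero' := by ext; simp
  map_add' S T := by ext; simp
  commutes' c := by ext; simp [Algebra.algebraMap_eq_smul_one]
  map_star' T := by
    refine (ContinuousLinearMap.eq_adjoint_iff _ _).2 fun f g => ?_
    simp [lp.inner_eq_tsum, ContinuousLinearMap.star_eq_adjoint,
      ContinuousLinearMap.adjoint_inner_left]

@[simp]
theorem amplification_apply [CompleteSpace H] (T : H →L[ℂ] H) (f : lp (fun _ : I => H) 2) (i : I) :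
    amplification H I T f i = T (f i) := rfl

theorem amplification_single [CompleteSpace H] [DecidableEq I] (T : H →L[ℂ] H) (i : I) (x : H) :
    amplification H I T (lp.single 2 i x) = lp.single (E := fun _ : I => H) 2 i (T x) :=
  diagonalOperator_single T i x

/-- Concatenating the two families over `I ⊕ J` lets one vector control finitely many. -/
theorem exists_norm_diagonalOperator_le {J : Type*} (f : lp (fun _ : I => H) 2)
    (g : lp (fun _ : J => H) 2) :
    ∃ h : lp (fun _ : I ⊕ J => H) 2, ∀ T : H →L[ℂ] H,
      ‖diagonalOperator T f‖ ≤ ‖diagonalOperator T h‖ ∧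
        ‖diagonalOperator T g‖ ≤ ‖diagonalOperator T h‖ := by
  have hmem : Memℓp (E := fun _ : I ⊕ J => H) (Sum.elim f g) 2 := by
    refine memℓp_gen ?_
    have hf := (memℓp_gen_iff (by norm_num)).1 (lp.memℓp f)
    have hg := (memℓp_gen_iff (by norm_num)).1 (lp.memℓp g)
    exact (hf.hasSum.sum (f := fun i => ‖Sum.elim f g i‖ ^ (2 : ENNReal).toReal)
      hg.hasSum).summable
  let h : lp (fun _ : I ⊕ J => H) 2 := ⟨_, hmem⟩
  refine ⟨h, fun T => ⟨?_, ?_⟩⟩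
  · refine lp.norm_le_of_forall_sum_le (by norm_num) (by positivity) fun s => ?_
    have hs := lp.sum_rpow_le_norm_rpow (p := 2) (by norm_num) (diagonalOperator T h) (s.map .inl)
    rwa [Finset.sum_map] at hs
  · refine lp.norm_le_of_forall_sum_le (by norm_num) (by positivity) fun s => ?_
    have hs := lp.sum_rpow_le_norm_rpow (p := 2) (by norm_num) (diagonalOperator T h) (s.map .inr)
    rwa [Finset.sum_map] at hs

end Amplification

/-! ### Ultraweak continuity and vector states -/

section Ultraweak

variable {H : Type*} [NormedAddCommGroup H] [InnerProductSpace ℂ H]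

/-- An ultraweak neighbourhood of `0` contains `T⋆ T` for all `T` that are small on a suitable
vector of an amplification of `H`. -/
theorem exists_star_mul_self_mem_of_mem_nhds_ultraweak [CompleteSpace H] {s : Set (H →L[ℂ] H)}
    (hs : s ∈ @nhds _ (ultraweakTopology H) 0) :
    ∃ (I : Type) (θ : lp (fun _ : I => H) 2), ∀ T : H →L[ℂ] H,
      ‖amplification H I T θ‖ < 1 → star T * T ∈ s := by
  simp only [nhds_iInf, nhds_induced] at hs
  rw [iInf_prod'] at hs
  refine Filter.iInf_sets_induct hs ⟨Empty, 0, fun _ _ => trivial⟩ ?_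
  rintro ⟨ξ, ζ⟩ s₁ s₂ h₁ ⟨I, θ, hθ⟩
  obtain ⟨u, hu, hus⟩ := Filter.mem_comap.1 h₁
  obtain ⟨ε, hε, hball⟩ := Metric.mem_nhds_iff.1 hu
  -- With this scaling, `‖Tκ‖ < 1` forces `‖Tξ‖ < ε` and `‖Tζ‖ < 1`, so Cauchy–Schwarz bounds the
  -- functional by `ε`.
  obtain ⟨χ, hχ⟩ := exists_norm_diagonalOperator_le ((ε⁻¹ : ℂ) • ξ) ζ
  obtain ⟨κ, hκ⟩ := exists_norm_diagonalOperator_le χ θ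
  refine ⟨_, κ, fun T hT => ⟨hus (hball ?_), hθ T ((hκ T).2.trans_lt hT)⟩⟩
  have h1 := ((hχ T).1.trans (hκ T).1).trans_lt hT
  have h2 := ((hχ T).2.trans (hκ T).1).trans_lt hT
  have h3 : ‖diagonalOperator T ξ‖ < ε := by
    rw [map_smul, norm_smul, norm_inv, Complex.norm_real, Real.norm_of_nonneg hε.le] at h1
    rwa [inv_mul_lt_iff₀ hε, mul_one] at h1
  have h4 : ∑' n, ⟪ξ n, (star T * T) (ζ n)⟫_ℂ = ⟪diagonalOperator T ξ, diagonalOperator T ζ⟫_ℂ := by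
    simp [lp.inner_eq_tsum, ContinuousLinearMap.star_eq_adjoint,
      ContinuousLinearMap.adjoint_inner_right]
  have h5 : ‖∑' n, ⟪ξ n, (star T * T) (ζ n)⟫_ℂ‖ < ε := by
    rw [h4]
    refine (norm_inner_le_norm _ _).trans_lt ?_
    calc _ ≤ ‖diagonalOperator T ξ‖ * 1 := by gcongr
      _ < ε := by simpa using h3
  simpa using h5

theorem continuous_inner_apply_ultraweak (η : H) :
    @Continuous _ _ (ultraweakTopology H) _ (fun T : H →L[ℂ] H => ⟪η, T η⟫_ℂ) := by
  have h : (fun T : H →L[ℂ] H => ⟪η, T η⟫_ℂ) = fun T : H →L[ℂ] H =>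
      ∑' n : ℕ, ⟪lp.single (E := fun _ : ℕ => H) 2 0 η n,
        T (lp.single (E := fun _ : ℕ => H) 2 0 η n)⟫_ℂ := by
    funext T
    rw [tsum_eq_single 0]
    · simp
    · intro n hn
      simp [hn]
  rw [h]
  exact continuous_iInf_dom (continuous_iInf_dom continuous_induced_dom)

/-- Vector states of a normal representation are dominated by vector states of an amplification. -/
theorem IsNormalRep.exists_norm_apply_le [CompleteSpace H] {K : Type*} [NormedAddCommGroup K]
    [InnerProductSpace ℂ K] [CompleteSpace K] {M : VonNeumannAlgebra H}
    {π : M.toStarSubalgebra →⋆ₐ[ℂ] (K →L[ℂ] K)} (hπ : IsNormalRep π) (η : K) :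
    ∃ (I : Type) (θ : lp (fun _ : I => H) 2), ∀ m : M.toStarSubalgebra,
      ‖π m η‖ ≤ ‖amplification H I m θ‖ := by
  let : TopologicalSpace M.toStarSubalgebra := (ultraweakTopology H).induced Subtype.val
  have hc : Continuous fun m : M.toStarSubalgebra => ⟪η, π m η⟫_ℂ :=
    @Continuous.comp _ _ _ _ (ultraweakTopology K) _ _ _ (continuous_inner_apply_ultraweak η) hπ
  have h0 : {m : M.toStarSubalgebra | ‖⟪η, π m η⟫_ℂ‖ < 1} ∈ nhds 0 :=
    (isOpen_lt hc.norm continuous_const).mem_nhds (by simp)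
  rw [@nhds_induced _ _ (ultraweakTopology H)] at h0
  obtain ⟨s, hs, hsub⟩ := Filter.mem_comap.1 h0
  obtain ⟨I, θ, hθ⟩ := exists_star_mul_self_mem_of_mem_nhds_ultraweak hs
  have key : ∀ m : M.toStarSubalgebra, ‖amplification H I m θ‖ < 1 → ‖π m η‖ < 1 := by
    intro m hm
    have h1 : ‖⟪η, π (star m * m) η⟫_ℂ‖ < 1 := @hsub (star m * m) (hθ m hm)
    rw [map_mul, map_star, ContinuousLinearMap.star_eq_adjoint, mul_apply_eq_comp,
      ContinuousLinearMap.adjoint_inner_right, inner_self_eq_norm_sq_to_K] at h1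
    have h2 : ‖π m η‖ ^ 2 < 1 := by simpa using h1
    nlinarith [norm_nonneg (π m η)]
  -- By homogeneity, `key` applied to `t⁻¹ m` turns the implication into an inequality of norms.
  refine ⟨I, θ, fun m => le_of_forall_gt fun t ht => ?_⟩
  have ht0 : 0 < t := (norm_nonneg _).trans_lt ht
  have h := key ((t⁻¹ : ℂ) • m) (by
    change ‖amplification H I ((t⁻¹ : ℂ) • (m : H →L[ℂ] H)) θ‖ < 1
    rw [map_smul, smul_apply, norm_smul, norm_inv, Complex.norm_real,
      Real.norm_of_nonneg ht0.le, inv_mul_lt_iff₀ ht0, mul_one]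
    exact ht)
  rwa [map_smul, smul_apply, norm_smul, norm_inv, Complex.norm_real,
    Real.norm_of_nonneg ht0.le, inv_mul_lt_iff₀ ht0, mul_one] at h

end Ultraweak

/-! ### Intertwiners and transfer of hyperinvariance -/

section Intertwiners

variable {R : Type*} [Ring R] [StarRing R] [Algebra ℂ R]
  {E : Type*} [NormedAddCommGroup E] [InnerProductSpace ℂ E] [CompleteSpace E]
  {F : Type*} [NormedAddCommGroup F] [InnerProductSpace ℂ F] [CompleteSpace F]
  {G : Type*} [NormedAddCommGroup G] [InnerProductSpace ℂ G] [CompleteSpace G]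

/-- `Y` intertwines the representations `ρ` and `σ`. -/
def Intertwines (ρ : R →⋆ₐ[ℂ] (E →L[ℂ] E)) (σ : R →⋆ₐ[ℂ] (F →L[ℂ] F)) (Y : E →L[ℂ] F) : Prop :=
  ∀ m x, Y (ρ m x) = σ m (Y x)

/-- The ranges of the intertwiners from `ρ` to `σ` are jointly total: only `0` is orthogonal to
all of them. -/
def IntertwinersTotal (ρ : R →⋆ₐ[ℂ] (E →L[ℂ] E)) (σ : R →⋆ₐ[ℂ] (F →L[ℂ] F)) : Prop :=
  ∀ z : F, (∀ Y : E →L[ℂ] F, Intertwines ρ σ Y → ∀ x, ⟪z, Y x⟫_ℂ = 0) → z = 0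

variable {ρ : R →⋆ₐ[ℂ] (E →L[ℂ] E)} {σ : R →⋆ₐ[ℂ] (F →L[ℂ] F)} {τ : R →⋆ₐ[ℂ] (G →L[ℂ] G)}

theorem inner_map_star_left (ρ : R →⋆ₐ[ℂ] (E →L[ℂ] E)) (m : R) (x y : E) :
    ⟪ρ (star m) x, y⟫_ℂ = ⟪x, ρ m y⟫_ℂ := by
  rw [map_star, ContinuousLinearMap.star_eq_adjoint, ContinuousLinearMap.adjoint_inner_left]

theorem Intertwines.adjoint {Y : E →L[ℂ] F} (hY : Intertwines ρ σ Y) :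
    Intertwines σ ρ (ContinuousLinearMap.adjoint Y) := by
  intro m x
  refine ext_inner_right ℂ fun y => ?_
  rw [ContinuousLinearMap.adjoint_inner_left, ← star_star m, inner_map_star_left,
    inner_map_star_left, ← hY, ContinuousLinearMap.adjoint_inner_left]

theorem Intertwines.comp {X : F →L[ℂ] G} {Y : E →L[ℂ] F} (hX : Intertwines σ τ X)
    (hY : Intertwines ρ σ Y) : Intertwines ρ τ (X ∘L Y) := fun m x => by
  simp [hY m x, hX m (Y x)]

theorem IntertwinersTotal.trans (h₁ : IntertwinersTotal ρ σ) (h₂ : IntertwinersTotal σ τ) :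
    IntertwinersTotal ρ τ := by
  refine fun z hz => h₂ z fun X hX y => ?_
  rw [← ContinuousLinearMap.adjoint_inner_left, h₁ (ContinuousLinearMap.adjoint X z), inner_zero_left]
  intro Y hY x
  rw [ContinuousLinearMap.adjoint_inner_left]
  exact hz _ (hX.comp hY) x

/-- Domination of a vector state gives an intertwiner that maps one vector to the other. -/
theorem exists_intertwines_apply_eq {θ : E} {η : F} (h : ∀ m, ‖σ m η‖ ≤ ‖ρ m θ‖) :
    ∃ T : E →L[ℂ] F, Intertwines ρ σ T ∧ T θ = η := by
  let e₀ : R →ₗ[ℂ] E :=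
    { toFun := fun m => ρ m θ
      map_add' := fun a b => by simp
      map_smul' := fun c a => by simp }
  let f : R →ₗ[ℂ] F :=
    { toFun := fun m => σ m η
      map_add' := fun a b => by simp
      map_smul' := fun c a => by simp }
  let D : Submodule ℂ E := e₀.range.topologicalClosure
  have he₀ : ∀ m, e₀ m ∈ D := fun m => Submodule.le_topologicalClosure _ ⟨m, rfl⟩
  let e : R →ₗ[ℂ] D := e₀.codRestrict D he₀
  have : CompleteSpace D := (Submodule.isClosed_topologicalClosure _).completeSpace_coe
  have hdense : DenseRange e := by
    intro x
    rw [closure_subtype]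
    convert x.2 using 1
    rw [← Set.range_comp]
    rfl
  have hbound : ∃ C, ∀ m, ‖f m‖ ≤ C * ‖e m‖ := ⟨1, fun m => by simpa using! h m⟩
  -- `T` extends `ρ m θ ↦ σ m η` to the closed cyclic subspace `D` and vanishes on `Dᗮ`, which is
  -- also `ρ`-invariant because `R` is closed under `star`.
  let T : E →L[ℂ] F := f.extendOfNorm e ∘L D.orthogonalProjectionOnto
  have hT : ∀ m, T (ρ m θ) = σ m η := by
    intro m
    have h1 : D.orthogonalProjectionOnto (ρ m θ) = e m :=
      Submodule.orthogonalProjectionOnto_mem_subspace_eq_self (e m)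
    simp only [T, ContinuousLinearMap.comp_apply, h1]
    exact LinearMap.extendOfNorm_eq hdense hbound m
  have hTperp : ∀ x ∈ Dᗮ, T x = 0 := fun x hx => by
    simp [T, Submodule.orthogonalProjectionOnto_apply_of_mem_orthogonal hx]
  have hperp : ∀ x, x ∈ Dᗮ ↔ ∀ m, ⟪ρ m θ, x⟫_ℂ = 0 := by
    intro x
    rw [Submodule.orthogonal_closure, Submodule.mem_orthogonal]
    exact ⟨fun hx m => hx _ ⟨m, rfl⟩, by rintro hx _ ⟨m, rfl⟩; exact hx m⟩
  refine ⟨T, fun m x => ?_, by simpa using hT 1⟩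
  have hD : ∀ y ∈ D, T (ρ m y) = σ m (T y) := by
    have hcl : IsClosed {y | T (ρ m y) = σ m (T y)} :=
      isClosed_eq (by fun_prop) (by fun_prop)
    refine fun y hy => closure_minimal ?_ hcl hy
    rintro _ ⟨n, rfl⟩
    change T (ρ m (ρ n θ)) = σ m (T (ρ n θ))
    rw [hT, ← mul_apply_eq_comp, ← map_mul, hT, map_mul, mul_apply_eq_comp]
  obtain ⟨y, hy, z, hz, rfl⟩ := D.exists_add_mem_mem_orthogonal x
  have hz' : ρ m z ∈ Dᗮ := by
    rw [hperp] at hz ⊢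
    intro n
    rw [← inner_map_star_left, ← mul_apply_eq_comp, ← map_mul]
    exact hz _
  simp only [map_add, hD y hy, hTperp z hz, hTperp _ hz', add_zero]

/-- If the intertwiners from `ρ` to `σ` are total, hyperinvariance passes from `ρ` to `σ`. -/
theorem IntertwinersTotal.isHyperinvariant (h : IntertwinersTotal ρ σ) {A p : R}
    (hp : IsStarProjection p) (hA : IsHyperinvariant (ρ A) (ρ p).range) :
    IsHyperinvariant (σ A) (σ p).range := by
  have hi := hp.isIdempotentElem
  have hρ : ∀ x, x ∈ (ρ p).range → ρ p x = x := by
    rintro _ ⟨x, rfl⟩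
    exact congr($(hi.map ρ) x)
  refine ⟨ContinuousLinearMap.IsIdempotentElem.isClosed_range (hi.map σ), fun S hS x hx => ?_⟩
  obtain ⟨x, rfl⟩ := hx
  have key : ∀ (Y : E →L[ℂ] F), Intertwines ρ σ Y → ∀ (X : F →L[ℂ] E), Intertwines σ ρ X →
      ∀ v, X (σ p (S (σ p (Y v)))) = X (S (σ p (Y v))) := by
    intro Y hY X hX v
    have hcomm : (X ∘L S ∘L Y) * ρ A = ρ A * (X ∘L S ∘L Y) := by
      ext w
      have := congr($hS (Y w))
      simp only [mul_apply_eq_comp] at this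
      simp [hY A w, this, hX A]
    have := hρ _ (hA.2 _ hcomm (ρ p v) ⟨v, rfl⟩)
    simpa [hY p, ← hX p] using this
  refine ⟨S (σ p x), ?_⟩
  change σ p (S (σ p x)) = S (σ p x)
  have main : ∀ (Y : E →L[ℂ] F), Intertwines ρ σ Y → ∀ v,
      σ p (S (σ p (Y v))) - S (σ p (Y v)) = 0 := by
    intro Y hY v
    refine h _ fun X hX w => ?_
    rw [← ContinuousLinearMap.adjoint_inner_left, map_sub, key Y hY _ hX.adjoint, sub_self,
      inner_zero_left]
  let B : F →L[ℂ] F := σ p * S * σ p - S * σ p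
  -- `B` kills the range of every intertwiner, so the range of `B⋆` is orthogonal to all of them.
  have hB : ∀ z, ContinuousLinearMap.adjoint B z = 0 := fun z => by
    refine h _ fun Y hY v => ?_
    rw [ContinuousLinearMap.adjoint_inner_left]
    have : B (Y v) = 0 := main Y hY v
    rw [this, inner_zero_right]
  have hB0 : B x = 0 := by
    refine ext_inner_left ℂ fun z => ?_
    rw [← ContinuousLinearMap.adjoint_inner_left, hB, inner_zero_left, inner_zero_right]
  exact sub_eq_zero.1 hB0

end Intertwiners

/-! ### Totality for normal and faithful representations -/

section Normal

variable {H : Type*} [NormedAddCommGroup H] [InnerProductSpace ℂ H] [CompleteSpace H]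
  {K : Type*} [NormedAddCommGroup K] [InnerProductSpace ℂ K] [CompleteSpace K]
  {M : VonNeumannAlgebra H} {π : M.toStarSubalgebra →⋆ₐ[ℂ] (K →L[ℂ] K)}

theorem IsNormalRep.intertwinersTotal (hπ : IsNormalRep π) :
    IntertwinersTotal M.toStarSubalgebra.subtype π := by
  classical
  intro z hz
  obtain ⟨I, θ, hθ⟩ := hπ.exists_norm_apply_le z
  obtain ⟨T, hT, hTθ⟩ := exists_intertwines_apply_eq
    (ρ := (amplification H I).comp M.toStarSubalgebra.subtype) (σ := π) hθ
  -- `θ` is the sum of its coordinates, and `T` restricted to each coordinate copy of `H`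
  -- intertwines. So `z` is orthogonal to every term of the series for `T θ = z`.
  have hsum := (lp.hasSum_single (by norm_num) θ).mapL (innerSL ℂ z ∘L T)
  have hzero : ∀ i, (innerSL ℂ z ∘L T) (lp.single 2 i (θ i)) = 0 := fun i =>
    hz (T ∘L lp.singleContinuousLinearMap ℂ (fun _ : I => H) 2 i) (fun m x => by
      have := hT m (lp.single 2 i x)
      exact congr(T $((amplification_single (m : H →L[ℂ] H) i x).symm)).trans this) (θ i)
  simp only [hzero] at hsum
  have := hsum.unique hasSum_zero
  simpa [hTθ] using this

/-- The common kernel `Z` of the intertwiners `H → K` is invariant under the commutant of `M`, so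
its projection lies in `M`. Since `π` annihilates that projection, injectivity gives `Z = 0`; taking
adjoints yields totality. -/
theorem IsNormalRep.intertwinersTotal_of_injective (hπ : IsNormalRep π)
    (hinj : Function.Injective π) : IntertwinersTotal π M.toStarSubalgebra.subtype := by
  let Z : Submodule ℂ H := ⨅ Y : {Y : H →L[ℂ] K // Intertwines M.toStarSubalgebra.subtype π Y},
    Y.1.ker
  have hmem : ∀ x, x ∈ Z ↔ ∀ Y : H →L[ℂ] K, Intertwines M.toStarSubalgebra.subtype π Y →
      Y x = 0 := fun x => by simp [Z]
  have hZ : IsClosed (Z : Set H) := by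
    simp only [Z, Submodule.coe_iInf]
    exact isClosed_iInter fun Y => Y.1.isClosed_ker
  have : CompleteSpace Z := hZ.completeSpace_coe
  have hq : Z.starProjection ∈ M := by
    rw [VonNeumannAlgebra.IsStarProjection.mem_iff isStarProjection_starProjection]
    intro y hy x hx
    simp only [Submodule.range_starProjection, Submodule.mem_comap] at hx ⊢
    rw [hmem] at hx ⊢
    refine fun Y hY => hx (Y ∘L y) fun m v => ?_
    have hc := congr($(VonNeumannAlgebra.mem_commutant_iff.1 hy m m.2) v)
    change Y (y (m.1 v)) = π m (Y (y v))
    rw [← hY]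
    exact congr(Y $hc.symm)
  let q : M.toStarSubalgebra := ⟨Z.starProjection, hq⟩
  have hπq : π q = 0 := by
    have hadj : ∀ z, ContinuousLinearMap.adjoint (π q) z = 0 := fun z => by
      refine hπ.intertwinersTotal _ fun Y hY x => ?_
      rw [ContinuousLinearMap.adjoint_inner_left, ← hY]
      have : Y (Z.starProjection x) = 0 := (hmem _).1 (Z.starProjection_apply_mem x) Y hY
      exact (congrArg _ this).trans (inner_zero_right _)
    ext x
    refine ext_inner_left ℂ fun z => ?_
    rw [← ContinuousLinearMap.adjoint_inner_left, hadj, inner_zero_left]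
    simp
  have hq0 : Z.starProjection = 0 := congrArg Subtype.val (hinj (hπq.trans (map_zero π).symm))
  intro z hz
  have hzZ : z ∈ Z := (hmem z).2 fun Y hY => by
    refine ext_inner_right ℂ fun x => ?_
    rw [← ContinuousLinearMap.adjoint_inner_right, hz _ hY.adjoint, inner_zero_left]
  rw [← Submodule.starProjection_eq_self_iff.2 hzZ, hq0]
  simp

end Normal

theorem mainTheorem5 {H : Type*} [NormedAddCommGroup H] [InnerProductSpace ℂ H] [CompleteSpace H]
    (M : VonNeumannAlgebra H) (A p : M.toStarSubalgebra) (hp : IsStarProjection p) :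
    (IsHyperinvariant (A : H →L[ℂ] H) (p : H →L[ℂ] H).range →
      ∀ (K : Type*) [NormedAddCommGroup K] [InnerProductSpace ℂ K] [CompleteSpace K]
        (π : M.toStarSubalgebra →⋆ₐ[ℂ] (K →L[ℂ] K)),
        IsNormalRep π → Function.Injective π →
          IsHyperinvariant (π A) (π p).range) ∧
    (∀ (K₁ : Type*) [NormedAddCommGroup K₁] [InnerProductSpace ℂ K₁] [CompleteSpace K₁]
        (K₂ : Type*) [NormedAddCommGroup K₂] [InnerProductSpace ℂ K₂] [CompleteSpace K₂]
        (π₁ : M.toStarSubalgebra →⋆ₐ[ℂ] (K₁ →L[ℂ] K₁))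
        (π₂ : M.toStarSubalgebra →⋆ₐ[ℂ] (K₂ →L[ℂ] K₂)),
        IsNormalRep π₁ → Function.Injective π₁ → IsNormalRep π₂ → Function.Injective π₂ →
          (IsHyperinvariant (π₁ A) (π₁ p).range ↔ IsHyperinvariant (π₂ A) (π₂ p).range)) := by
  refine ⟨fun hA K _ _ _ π hπ _ => hπ.intertwinersTotal.isHyperinvariant hp hA, ?_⟩
  intro K₁ _ _ _ K₂ _ _ _ π₁ π₂ hπ₁ hi₁ hπ₂ hi₂
  exact ⟨((hπ₁.intertwinersTotal_of_injective hi₁).trans hπ₂.intertwinersTotal).isHyperinvariant hp,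
    ((hπ₂.intertwinersTotal_of_injective hi₂).trans hπ₁.intertwinersTotal).isHyperinvariant hp⟩
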